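/- **Theorem (Parseval identity).** Let $g=\sum_{i=1}^n g_i\,\delta_{\xi_i}$ with $g_i>0$ and $0<\xi_1<\dots<\xi_n\le 1$ (a discrete cubic string; the case $\xi_n=1$ is called degenerate). Differential equations involving $g$ are understood in the sense of distributions, with $\phi,\phi_\xi$ continuous and $\phi_{\xi\xi}$ right-continuous; in the degenerate case derivatives at $1$ are right-hand limits. Put $(f,h)_g=\int fh\,dg$ (bilinear) for $f,h\in L^2_g=L^2([0,1],g)$ (complex valued). For $z\in\mathbb C$ let $\phi(\xi;z)$ be the solution of $-\phi_{\xi\xi\xi}=z g\phi$, $\phi(0)=\phi_\xi(0)=0$, $\phi_{\xi\xi}(0)=1$. For $a=0,1,2$ let $\phi_a^*(\xi;z)$ be the solution of $\phi^*_{\xi\xi\xi}=zg\phi^*$ with $(\phi^*,\phi^*_\xi,\phi^*_{\xi\xi})(1)$ equal to $(0,0,1)$, $(0,1,0)$, $(1,0,0)$ respectively. The spectrum of type $a$ is the set of $z\in\mathbb C$ for which $-\phi_{\xi\xi\xi}=zg\phi$, $\phi(0)=\phi_\xi(0)=0$ has a nonzero solution on $[0,1]$ with $\phi(1)=0$ ($a=0$),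 $\phi_\xi(1)=0$ ($a=1$), $\phi_{\xi\xi}(1)=0$ ($a=2$). The Weyl functions are $$W_0=\frac{\phi_\xi(1;z)}{\phi(1;z)},\quad Z_0=\frac{\phi_{\xi\xi}(1;z)}{\phi(1;z)},\quad W_1=-\frac{\phi(1;z)}{\phi_\xi(1;z)},\quad Z_1=\frac{\phi_{\xi\xi}(1;z)}{\phi_\xi(1;z)},\quad W_2=-\frac{\phi_\xi(1;z)}{\phi_{\xi\xi}(1;z)},\quad Z_2=-\frac{\phi(1;z)}{\phi_{\xi\xi}(1;z)} .$$ Let $(a,b)$ be one of $(0,0),(0,1),(1,2),(2,2)$ (only $(2,2)$ in the degenerate case), and let $(M,N)$ be correspondingly $(W_0,W_0)$, $(Z_0,W_1)$, $(Z_1,Z_2)$, $(W_2,W_2)$. Then the spectra of types $a$ and $b$ are finite sets of positive real numbers, $M$ (resp. $N$) has a simple pole with positive residue at each point of the spectrum of type $a$ (resp. $b$), and for the positive discrete measures $$d\alpha=\sum_{x\in\text{spectrum of type }a}\operatorname{Res}_x M\;\delta_x,\qquad d\beta=\sum_{y\in\text{spectrum of type }b}\operatorname{Res}_y N\;\delta_y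 ,$$ the Cauchy pairing $\langle p|q\rangle=\iint\frac{p(x)q(y)}{x+y}\,d\alpha(x)\,d\beta(y)$ and the generalized Fourier transforms $\hat f_a(z)=(-1)^a\int\phi_a^*(\xi;z)f(\xi)\,dg(\xi)$, one has, for all $f,h\in L^2_g$, $$(f,h)_g=\langle\hat f_a|\hat h_b\rangle=\langle\hat h_a|\hat f_b\rangle .$$ -/

import Mathlib

open MeasureTheory Filter Topology Set

/-- The data of a discrete cubic string: finitely many positive point masses at positions
`0 < ξ₁ < ⋯ < ξₙ ≤ 1`.  The value `ξₙ = 1` is the degenerate case. -/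
structure DiscreteCubicString where
  /-- the number of point masses -/
  n : ℕ
  /-- the positions of the masses -/
  pos : Fin n → ℝ
  /-- the weights of the masses -/
  wt : Fin n → ℝ
  strictMono_pos : StrictMono pos
  pos_pos : ∀ i, 0 < pos i
  pos_le_one : ∀ i, pos i ≤ 1
  wt_pos : ∀ i, 0 < wt i

namespace DiscreteCubicString

variable (S : DiscreteCubicString)

/-- The nondegenerate case: all masses lie in the open interval `(0, 1)`. -/
def Nondegenerate : Prop := ∀ i, S.pos i < 1

/-- The mass distribution `g = ∑ gᵢ δ_{ξᵢ}`. -/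
noncomputable def mass : Measure ℝ :=
  ∑ i, ENNReal.ofReal (S.wt i) • Measure.dirac (S.pos i)

/-- `S.IsSolution c F` says that `f = F 0` solves `f_{ξξξ} = c g f` on the string, where
`F 1 = f_ξ` and `F 2 = f_{ξξ}`.  Since `g` is a measure, `f_{ξξ}` is a step function; it is
normalized to be right-continuous, so that it jumps by `c gᵢ f(ξᵢ)` at `ξᵢ`.
In particular the values at `1` are the right-hand limits if there is a mass at `1`. -/
structure IsSolution (c : ℂ) (F : Fin 3 → ℝ → ℂ) : Prop where
  eq_zero : ∀ x ∈ Icc (0 : ℝ) 1, F 0 x = F 0 0 + ∫ t in (0 : ℝ)..x, F 1 t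
  eq_one : ∀ x ∈ Icc (0 : ℝ) 1, F 1 x = F 1 0 + ∫ t in (0 : ℝ)..x, F 2 t
  eq_two : ∀ x ∈ Icc (0 : ℝ) 1, F 2 x = F 2 0 + c * ∫ t in Ioc (0 : ℝ) x, F 0 t ∂S.mass

/-! ### Existence of solutions of the initial value problems -/

theorem setIntegral_mass (f : ℝ → ℂ) (x : ℝ) :
    ∫ t in Ioc (0 : ℝ) x, f t ∂S.mass
      = ∑ i, if S.pos i ≤ x then (S.wt i : ℂ) * f (S.pos i) else 0 := by
  rw [← integral_indicator measurableSet_Ioc, mass, integral_finsetSum_measure]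
  · refine Finset.sum_congr rfl fun i _ => ?_
    rw [integral_smul_measure, integral_dirac, ENNReal.toReal_ofReal (S.wt_pos i).le]
    by_cases h : S.pos i ≤ x
    · simp [h, S.pos_pos i]
    · simp [h]
  · intro i _
    exact (integrable_dirac (by simp)).smul_measure ENNReal.ofReal_ne_top

theorem exists_triangular {ι : Type*} [Fintype ι] (r : ι → ι → Prop) [DecidableRel r]
    (hr : WellFounded r) (p : ι → ℂ) (W : ι → ι → ℂ) :
    ∃ y : ι → ℂ, ∀ k, y k = p k + ∑ i, if r i k then W k i * y i else 0 := by
  refine ⟨hr.fix fun k y => p k + ∑ i, if h : r i k then W k i * y i h else 0, fun k => ?_⟩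
  rw [hr.fix_eq]
  simp

/-- The positive part of `x` as a complex number. -/
noncomputable def ramp (x : ℝ) : ℂ := ((max x 0 : ℝ) : ℂ)

/-- The right-continuous indicator of `x ≥ 0`. -/
noncomputable def step (x : ℝ) : ℂ := if 0 ≤ x then 1 else 0

theorem hasDerivWithinAt_ramp (x : ℝ) : HasDerivWithinAt ramp (step x) (Ioi x) x := by
  by_cases h : 0 ≤ x
  · have h1 : HasDerivWithinAt (fun y : ℝ => (y : ℂ)) 1 (Ioi x) x :=
      (Complex.ofRealCLM.hasDerivAt (x := x)).hasDerivWithinAt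
    have : step x = 1 := by simp [step, h]
    rw [this]
    refine h1.congr (fun y hy => ?_) ?_
    · simp only [ramp]; rw [max_eq_left (h.trans (le_of_lt hy))]
    · simp only [ramp]; rw [max_eq_left h]
  · have : step x = 0 := by simp [step, h]
    rw [this]
    push Not at h
    refine HasDerivAt.hasDerivWithinAt ?_
    refine (hasDerivAt_const x (0 : ℂ)).congr_of_eventuallyEq ?_
    filter_upwards [Iio_mem_nhds h] with y hy
    simp [ramp, max_eq_right (le_of_lt (show y < 0 from hy))]

theorem continuous_ramp : Continuous ramp := by
  unfold ramp; fun_prop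

theorem hasDerivAt_ramp_sq (x : ℝ) : HasDerivAt (fun y => ramp y ^ 2 / 2) (ramp x) x := by
  rcases lt_trichotomy x 0 with h | h | h
  · have : ramp x = 0 := by simp [ramp, h.le]
    rw [this]
    refine (hasDerivAt_const x (0 : ℂ)).congr_of_eventuallyEq ?_
    filter_upwards [Iio_mem_nhds h] with y hy
    simp [ramp, max_eq_right (le_of_lt (show y < 0 from hy))]
  · subst h
    have h0 : ramp 0 = 0 := by simp [ramp]
    rw [h0, hasDerivAt_iff_isLittleO]
    simp only [h0, sub_zero, smul_zero]
    have : (fun y : ℝ => ramp y ^ 2 / 2) =O[𝓝 0] fun y : ℝ => y ^ 2 := by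
      refine Asymptotics.IsBigO.of_bound 1 (Eventually.of_forall fun y => ?_)
      have hb : |max y 0| ≤ |y| := by
        rcases le_total y 0 with hy | hy <;> simp [hy]
      have hb2 : |max y 0| ^ 2 ≤ |y| ^ 2 := pow_le_pow_left₀ (abs_nonneg _) hb 2
      simp only [ramp, norm_div, norm_pow, Complex.norm_real, Real.norm_eq_abs, one_mul]
      have h2 : ‖(2 : ℂ)‖ = 2 := by simp
      rw [h2]
      nlinarith [sq_nonneg |max y 0|]
    have h3 : (fun y : ℝ => y ^ 2) =o[𝓝 0] fun y : ℝ => y := by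
      simpa using Asymptotics.isLittleO_pow_pow (𝕜 := ℝ) (m := 1) (n := 2) (by norm_num)
    simpa using this.trans_isLittleO h3
  · have h1 : HasDerivAt (fun y : ℝ => (y : ℂ)) 1 x := Complex.ofRealCLM.hasDerivAt (x := x)
    have h2 := (h1.pow 2).div_const 2
    have : ramp x = (x : ℂ) := by simp [ramp, h.le]
    rw [this]
    refine (h2.congr_deriv (by push_cast; ring)).congr_of_eventuallyEq ?_
    filter_upwards [Ioi_mem_nhds h] with y hy
    simp [ramp, max_eq_left (le_of_lt (show 0 < y from hy))]

theorem measurable_step : Measurable step := by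
  unfold step
  exact Measurable.ite measurableSet_Ici measurable_const measurable_const

theorem norm_step_le (x : ℝ) : ‖step x‖ ≤ 1 := by
  unfold step; split_ifs <;> simp

/-- Piecewise quadratic functions with right-continuous second derivative, whose third
derivative is `c g f`, solve the equation. -/
theorem isSolution_ansatz (c p₀ p₁ p₂ : ℂ) (y : Fin S.n → ℂ)
    (hy : ∀ k, y k = p₀ + p₁ * S.pos k + p₂ * ((S.pos k : ℂ) ^ 2 / 2)
      + ∑ i, c * S.wt i * y i * (ramp (S.pos k - S.pos i) ^ 2 / 2)) :
    S.IsSolution c ![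
      fun x => p₀ + p₁ * x + p₂ * ((x : ℂ) ^ 2 / 2)
        + ∑ i, c * S.wt i * y i * (ramp (x - S.pos i) ^ 2 / 2),
      fun x => p₁ + p₂ * x + ∑ i, c * S.wt i * y i * ramp (x - S.pos i),
      fun x => p₂ + ∑ i, c * S.wt i * y i * step (x - S.pos i)] := by
  have hid : ∀ x : ℝ, HasDerivAt (fun y : ℝ => (y : ℂ)) 1 x :=
    fun x => Complex.ofRealCLM.hasDerivAt (x := x)
  have hstep : ∀ i, step (0 - S.pos i) = 0 := fun i => by
    have := S.pos_pos i
    simp [step, this]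
  refine ⟨fun x _ => ?_, fun x _ => ?_, fun x hx => ?_⟩
  · simp only [Matrix.cons_val]
    rw [intervalIntegral.integral_eq_sub_of_hasDerivAt
      (f := fun x : ℝ => p₀ + p₁ * x + p₂ * ((x : ℂ) ^ 2 / 2)
        + ∑ i, c * S.wt i * y i * (ramp (x - S.pos i) ^ 2 / 2))]
    · ring
    · intro t _
      have h1 := (((hid t).const_mul p₁).const_add p₀).add
        ((((hid t).pow 2).div_const 2).const_mul p₂)
      have h2 : HasDerivAt (fun x => ∑ i, c * S.wt i * y i * (ramp (x - S.pos i) ^ 2 / 2))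
          (∑ i, c * S.wt i * y i * ramp (t - S.pos i)) t :=
        HasDerivAt.fun_sum fun i _ =>
          ((hasDerivAt_ramp_sq (t - S.pos i)).comp_sub_const t (S.pos i)).const_mul _
      exact (h1.add h2).congr_deriv (by push_cast; ring)
    · refine Continuous.intervalIntegrable ?_ _ _
      have := continuous_ramp
      fun_prop
  · simp only [Matrix.cons_val]
    rw [intervalIntegral.integral_eq_sub_of_hasDeriv_right
      (f := fun x : ℝ => p₁ + p₂ * x + ∑ i, c * S.wt i * y i * ramp (x - S.pos i))]
    · ring
    · have := continuous_ramp
      fun_prop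
    · intro t _
      have h1 := (((hid t).const_mul p₂).const_add p₁).hasDerivWithinAt (s := Ioi t)
      have h2 : HasDerivWithinAt (fun x => ∑ i, c * S.wt i * y i * ramp (x - S.pos i))
          (∑ i, c * S.wt i * y i * step (t - S.pos i)) (Ioi t) t := by
        refine HasDerivWithinAt.fun_sum fun i _ => HasDerivWithinAt.const_mul _ ?_
        have h3 := (hasDerivWithinAt_ramp (t - S.pos i)).scomp t
          (((hasDerivAt_id t).sub_const (S.pos i)).hasDerivWithinAt (s := Ioi t))
          (fun u hu => by simpa using hu)
        simpa [Function.comp_def] using h3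
      exact (h1.add h2).congr_deriv (by ring)
    · refine (intervalIntegrable_const).add ?_
      have hsum : (fun x => ∑ i, c * S.wt i * y i * step (x - S.pos i))
          = ∑ i, fun x => c * S.wt i * y i * step (x - S.pos i) := by
        ext u; simp
      rw [hsum]
      refine IntervalIntegrable.sum _ fun i _ => IntervalIntegrable.const_mul ?_ _
      refine (intervalIntegrable_const (c := (1 : ℝ))).mono_fun ?_ ?_
      · exact (measurable_step.comp (measurable_id.sub_const _)).aestronglyMeasurable
      · exact Eventually.of_forall fun u => by simpa using norm_step_le (u - S.pos i)
  · rw [S.setIntegral_mass]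
    simp only [Matrix.cons_val, hstep, mul_zero, Finset.sum_const_zero, add_zero, ← hy]
    rw [Finset.mul_sum]
    congr 1
    refine Finset.sum_congr rfl fun i _ => ?_
    by_cases h : S.pos i ≤ x
    · simp [step, h]; ring
    · simp [step, h]

/-- The third order equation has a solution with arbitrary values of `f, f_ξ, f_{ξξ}` at `0`. -/
theorem exists_isSolution_zero (c : ℂ) (v : Fin 3 → ℂ) :
    ∃ F, S.IsSolution c F ∧ ∀ k, F k 0 = v k := by
  obtain ⟨y, hy⟩ := exists_triangular (fun i k : Fin S.n => i < k) wellFounded_lt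
    (fun k => v 0 + v 1 * S.pos k + v 2 * ((S.pos k : ℂ) ^ 2 / 2))
    (fun k i => c * S.wt i * (ramp (S.pos k - S.pos i) ^ 2 / 2))
  refine ⟨_, S.isSolution_ansatz c (v 0) (v 1) (v 2) y fun k => ?_, fun k => ?_⟩
  · rw [hy]
    congr 1
    refine Finset.sum_congr rfl fun i _ => ?_
    by_cases h : i < k
    · simp only [h, if_true]; ring
    · have : S.pos k ≤ S.pos i := S.strictMono_pos.monotone (not_lt.mp h)
      simp [h, ramp, this]
  · have h1 : ∀ i, ramp (0 - S.pos i) = 0 := fun i => by simp [ramp, (S.pos_pos i).le]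
    have h2 : ∀ i, step (0 - S.pos i) = 0 := fun i => by
      have := S.pos_pos i
      simp [step, this]
    fin_cases k <;> simp only [Matrix.cons_val, Fin.zero_eta, Fin.mk_one, Fin.reduceFinMk, h1, h2]
      <;> simp

/-- The third order equation has a solution with arbitrary values of `f, f_ξ, f_{ξξ}` at `1`. -/
theorem exists_isSolution_one (c : ℂ) (v : Fin 3 → ℂ) :
    ∃ F, S.IsSolution c F ∧ ∀ k, F k 1 = v k := by
  obtain ⟨y, hy⟩ := exists_triangular (fun i k : Fin S.n => k < i) wellFounded_gt
    (fun k => v 0 + v 1 * (S.pos k - 1) + v 2 * (((S.pos k : ℂ) - 1) ^ 2 / 2))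
    (fun k i => -(c * S.wt i * (((S.pos k : ℂ) - S.pos i) ^ 2 / 2)))
  have hr : ∀ i, ramp (1 - S.pos i) = 1 - S.pos i := fun i => by
    simp [ramp, S.pos_le_one i]
  have hs : ∀ i, step (1 - S.pos i) = 1 := fun i => by simp [step, S.pos_le_one i]
  refine ⟨_, S.isSolution_ansatz c
    (v 0 - v 1 + v 2 / 2 - ∑ i, c * S.wt i * y i * ((S.pos i : ℂ) ^ 2 / 2))
    (v 1 - v 2 + ∑ i, c * S.wt i * y i * S.pos i)
    (v 2 - ∑ i, c * S.wt i * y i) y fun k => ?_, fun k => ?_⟩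
  · have key : ∀ i, (if k < i then -(c * S.wt i * (((S.pos k : ℂ) - S.pos i) ^ 2 / 2)) * y i else 0)
        = -(c * S.wt i * y i * (((S.pos k : ℂ) - S.pos i) ^ 2 / 2))
          + c * S.wt i * y i * (ramp (S.pos k - S.pos i) ^ 2 / 2) := by
      intro i
      by_cases h : k < i
      · have : S.pos k ≤ S.pos i := (S.strictMono_pos h).le
        simp only [h, if_true, ramp, sub_nonpos, this, max_eq_right]
        push_cast; ring
      · have : S.pos i ≤ S.pos k := S.strictMono_pos.monotone (not_lt.mp h)
        simp only [h, if_false, ramp, sub_nonneg, this, max_eq_left]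
        push_cast; ring
    rw [hy, Finset.sum_congr rfl fun i _ => key i, Finset.sum_add_distrib, ← add_assoc]
    congr 1
    simp only [sub_mul, add_mul, Finset.sum_mul, Finset.sum_neg_distrib]
    have : ∀ i, c * S.wt i * y i * (((S.pos k : ℂ) - S.pos i) ^ 2 / 2)
        = c * S.wt i * y i * ((S.pos i : ℂ) ^ 2 / 2) - c * S.wt i * y i * S.pos i * S.pos k
          + c * S.wt i * y i * ((S.pos k : ℂ) ^ 2 / 2) := fun i => by ring
    simp only [this, Finset.sum_add_distrib, Finset.sum_sub_distrib]
    ring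
  · fin_cases k
    · simp only [Matrix.cons_val, Fin.zero_eta, hr]
      have : ∀ i, c * S.wt i * y i * ((1 - (S.pos i : ℂ)) ^ 2 / 2)
        = c * S.wt i * y i * ((S.pos i : ℂ) ^ 2 / 2) - c * S.wt i * y i * S.pos i
          + c * S.wt i * y i * (1 / 2) := fun i => by ring
      simp only [this, Finset.sum_add_distrib, Finset.sum_sub_distrib, ← Finset.sum_mul]
      push_cast; ring
    · simp only [Matrix.cons_val, Fin.mk_one, hr, mul_sub, mul_one, Finset.sum_sub_distrib]
      push_cast; ring
    · simp only [Matrix.cons_val, Fin.reduceFinMk, hs, mul_one]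
      ring

/-! ### The initial and boundary value problems -/

/-- The solution `(φ, φ_ξ, φ_{ξξ})(ξ; z)` of `-φ_{ξξξ} = z g φ` with `φ(0) = φ_ξ(0) = 0` and
`φ_{ξξ}(0) = 1`; its restriction to `[0, 1]` is uniquely determined.
`S.phi z k ξ` is the `k`-th derivative of `φ(·; z)` at `ξ`. -/
noncomputable def phi (z : ℂ) : Fin 3 → ℝ → ℂ :=
  (S.exists_isSolution_zero (-z) ![0, 0, 1]).choose

theorem phi_spec (z : ℂ) :
    S.IsSolution (-z) (S.phi z) ∧ ∀ k, S.phi z k 0 = ![0, 0, 1] k :=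
  (S.exists_isSolution_zero (-z) ![0, 0, 1]).choose_spec

/-- The values `(φ*(1), φ*_ξ(1), φ*_{ξξ}(1))` for the adjoint initial value problem of
type `a`. -/
def adjointValue : Fin 3 → Fin 3 → ℂ :=
  ![![0, 0, 1], ![0, 1, 0], ![1, 0, 0]]

/-- The solution `(φ*_a, φ*_{a,ξ}, φ*_{a,ξξ})(ξ; z)` of `φ*_{ξξξ} = z g φ*` with the
values `adjointValue a` at `1`; its restriction to `[0, 1]` is uniquely determined. -/
noncomputable def phiStar (a : Fin 3) (z : ℂ) : Fin 3 → ℝ → ℂ :=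
  (S.exists_isSolution_one z (adjointValue a)).choose

theorem phiStar_spec (a : Fin 3) (z : ℂ) :
    S.IsSolution z (S.phiStar a z) ∧ ∀ k, S.phiStar a z k 1 = adjointValue a k :=
  (S.exists_isSolution_one z (adjointValue a)).choose_spec

/-- The spectrum of the boundary value problem of type `a`:
`-φ_{ξξξ} = z g φ`, `φ(0) = φ_ξ(0) = 0`, and `φ(1) = 0` (type 0), `φ_ξ(1) = 0` (type 1),
`φ_{ξξ}(1) = 0` (type 2). -/
def spectrum (a : Fin 3) : Set ℂ :=
  {z | ∃ F, S.IsSolution (-z) F ∧ F 0 0 = 0 ∧ F 1 0 = 0 ∧ F a 1 = 0 ∧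
    ∃ x ∈ Icc (0 : ℝ) 1, F 0 x ≠ 0}

/-! ### Weyl functions and spectral measures -/

/-- The Weyl function `W` of type `a`. -/
noncomputable def weylW : Fin 3 → ℂ → ℂ :=
  ![fun z => S.phi z 1 1 / S.phi z 0 1,
    fun z => -(S.phi z 0 1 / S.phi z 1 1),
    fun z => -(S.phi z 1 1 / S.phi z 2 1)]

/-- The Weyl function `Z` of type `a`. -/
noncomputable def weylZ : Fin 3 → ℂ → ℂ :=
  ![fun z => S.phi z 2 1 / S.phi z 0 1,
    fun z => S.phi z 2 1 / S.phi z 1 1,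
    fun z => -(S.phi z 0 1 / S.phi z 2 1)]

/-- The residue of `M` at `z`, where `M` has at most a simple pole. -/
noncomputable def residue (M : ℂ → ℂ) (z : ℂ) : ℂ :=
  limUnder (𝓝[≠] z) fun w => (w - z) * M w

/-- The discrete measure `∑ Res_{x} M • δ_x`, summed over the points `x` of the spectrum of
type `a`. -/
noncomputable def spectralMeasure (a : Fin 3) (M : ℂ → ℂ) : Measure ℝ :=
  Measure.sum fun x : {x : ℝ // (x : ℂ) ∈ S.spectrum a} =>
    ENNReal.ofReal (residue M (x.1 : ℂ)).re • Measure.dirac x.1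

/-- The spectrum of type `a` is a finite set of positive real numbers, at each of which `M` has
a simple pole with a positive residue. -/
def PositiveSimplePoles (a : Fin 3) (M : ℂ → ℂ) : Prop :=
  (S.spectrum a).Finite ∧ ∀ z ∈ S.spectrum a, ∃ x A : ℝ, 0 < x ∧ 0 < A ∧ z = x ∧
    Tendsto (fun w => (w - z) * M w) (𝓝[≠] z) (𝓝 (A : ℂ))

/-- The bilinear form `(f, h)_g = ∫ f h g dξ`. -/
noncomputable def form (f h : ℝ → ℂ) : ℂ := ∫ x, f x * h x ∂S.mass

/-- The generalized Fourier transform of type `a`. -/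
noncomputable def fourier (a : Fin 3) (f : ℝ → ℂ) (z : ℂ) : ℂ :=
  (-1) ^ (a : ℕ) * ∫ x, S.phiStar a z 0 x * f x ∂S.mass

end DiscreteCubicString

/-- The Cauchy pairing `⟨p | q⟩ = ∬ p(x) q(y) / (x + y) dα(x) dβ(y)`. -/
noncomputable def cauchyPairing (α β : Measure ℝ) (p q : ℝ → ℂ) : ℂ :=
  ∫ x, ∫ y, p x * q y / ((x : ℂ) + y) ∂β ∂α

/-- The pairs of types of boundary value problems for which `(φ_{a,i}, φ_{b,j})_g`
factorizes. -/
inductive FactorizingPair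
  | type00
  | type01
  | type12
  | type22

namespace FactorizingPair

/-- The first type `a` of the pair. -/
def fst : FactorizingPair → Fin 3
  | type00 => 0
  | type01 => 0
  | type12 => 1
  | type22 => 2

/-- The second type `b` of the pair. -/
def snd : FactorizingPair → Fin 3
  | type00 => 0
  | type01 => 1
  | type12 => 2
  | type22 => 2

/-- The Weyl function, of the first type of the pair, whose residues are the weights of `α`. -/
noncomputable def fstWeyl (S : DiscreteCubicString) : FactorizingPair → ℂ → ℂ
  | type00 => S.weylW 0
  | type01 => S.weylZ 0
  | type12 => S.weylZ 1
  | type22 => S.weylW 2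

/-- The Weyl function, of the second type of the pair, whose residues are the weights of `β`. -/
noncomputable def sndWeyl (S : DiscreteCubicString) : FactorizingPair → ℂ → ℂ
  | type00 => S.weylW 0
  | type01 => S.weylW 1
  | type12 => S.weylZ 2
  | type22 => S.weylW 2

/-- The measure `α`. -/
noncomputable def alpha (P : FactorizingPair) (S : DiscreteCubicString) : Measure ℝ :=
  S.spectralMeasure P.fst (P.fstWeyl S)

/-- The measure `β`. -/
noncomputable def beta (P : FactorizingPair) (S : DiscreteCubicString) : Measure ℝ :=
  S.spectralMeasure P.snd (P.sndWeyl S)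

end FactorizingPair

/-!
Between the masses a solution is a quadratic polynomial, and at a mass `φ_{ξξ}` jumps by a multiple
of `φ`. Hence `φ(1; z)`, `φ_ξ(1; z)`, `φ_{ξξ}(1; z)` are real polynomials `χ₀, χ₁, χ₂` in `z`, whose
roots form the three spectra, and the Weyl functions are quotients `± χⱼ / χᵢ`.

Both steps preserve the following property for `Im z > 0`: the quotients `χᵢ / χⱼ` and `z χᵢ / χⱼ`,
`i < j`, lie in the closed upper half-plane. Letting `z` approach the real line, the Wronskians of
`(χᵢ, χⱼ)` and of `(z χᵢ, χⱼ)` are nonnegative, the latter strictly positive. At a root of `χᵢ` or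
`χⱼ` this says that the root is positive and simple and that the residue is positive.

By Lagrange's identity, `φ(·; x)` and `φ*_a(·; y)` for `x, y` in the spectrum of type `a` are
biorthogonal in `L²_g`. Unless the string is degenerate and `a ≠ 2`, in which case the degree of
`χ_a` drops, there are as many of these `x` as masses, so every function is the sum of its
eigenfunction expansion, with coefficients `-f̂_a(x) / χ_a'(x)`. Again by Lagrange's identity,
`(x + y) (φ(·; x), φ(·; y))_g` is a bilinear expression in the `χᵢ(x)` and `χⱼ(y)`. For the four
pairs `(a, b)` the boundary conditions leave a single term of it, the product of the numerators of
the two residues, and expanding both arguments of the form yields the Cauchy pairing.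
-/

section

open Polynomial
open scoped ComplexConjugate

theorem integral_sum_ofReal_smul_dirac {ι : Type*} [Fintype ι] {w : ι → ℝ} (hw : ∀ i, 0 ≤ w i)
    (p : ι → ℝ) (f : ℝ → ℂ) :
    ∫ x, f x ∂Measure.sum (fun i => ENNReal.ofReal (w i) • Measure.dirac (p i)) =
      ∑ i, (w i : ℂ) * f (p i) := by
  rw [integral_sum_dirac fun i => ENNReal.ofReal_ne_top, tsum_fintype]
  simp only [ENNReal.toReal_ofReal (hw _), Complex.real_smul]

theorem eq_sum_smul_of_biorthogonal {K ι κ : Type*} [Field K] [Fintype ι] [Fintype κ]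
    [DecidableEq κ] (hcard : Fintype.card κ = Fintype.card ι) {φ ψ : κ → ι → K} {d : κ → K}
    (hd : ∀ x, d x ≠ 0) (horth : ∀ x y, ∑ i, φ x i * ψ y i = if x = y then d x else 0)
    (f : ι → K) : f = ∑ x, ((∑ i, ψ x i * f i) / d x) • φ x := by
  classical
  let U : Matrix κ ι K := Matrix.of φ
  let V : Matrix ι κ K := Matrix.of fun i y => ψ y i / d y
  have hUV : U * V = 1 := by
    ext x y
    simp only [U, V, Matrix.mul_apply, Matrix.of_apply, mul_div_assoc', ← Finset.sum_div, horth,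
      Matrix.one_apply]
    split_ifs with h
    · rw [h, div_self (hd y)]
    · rw [zero_div]
  have hVU : V * U = 1 := (Matrix.mul_eq_one_comm_of_card_eq _ _ _ hcard).1 hUV
  calc f = Matrix.vecMul f (V * U) := by rw [hVU, Matrix.vecMul_one]
    _ = Matrix.vecMul (Matrix.vecMul f V) U := (Matrix.vecMul_vecMul _ _ _).symm
    _ = ∑ x, ((∑ i, ψ x i * f i) / d x) • φ x := by
      rw [Matrix.vecMul_eq_sum]
      refine Finset.sum_congr rfl fun x _ => congrArg (· • φ x) ?_
      simp only [V, Matrix.vecMul, dotProduct, Matrix.of_apply, Finset.sum_div]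
      exact Finset.sum_congr rfl fun i _ => by ring

theorem tendsto_sub_mul_div_of_simple_zero {𝕜 : Type*} [NontriviallyNormedField 𝕜]
    {p q : 𝕜 → 𝕜} {q' x : 𝕜} (hp : ContinuousAt p x) (hq : HasDerivAt q q' x) (hqx : q x = 0)
    (hq' : q' ≠ 0) : Tendsto (fun w => (w - x) * (p w / q w)) (𝓝[≠] x) (𝓝 (p x / q')) := by
  have hslope : Tendsto (slope q x) (𝓝[≠] x) (𝓝 q') := hasDerivAt_iff_tendsto_slope.1 hq
  refine ((hp.tendsto.mono_left nhdsWithin_le_nhds).div hslope hq').congr fun w => ?_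
  simp only [slope_def_field, hqx, sub_zero, Pi.div_apply]
  rw [div_div_eq_mul_div, mul_comm (p w), mul_div_assoc]

theorem card_roots_toFinset_of_complex_roots_real {p : ℝ[X]}
    (hreal : ∀ z : ℂ, aeval z p = 0 → z.im = 0)
    (hsimple : ∀ x, p.eval x = 0 → (derivative p).eval x ≠ 0) :
    p.roots.toFinset.card = p.natDegree := by
  have hsplits : p.Splits := by
    refine Splits.of_splits_map (algebraMap ℝ ℂ) (IsAlgClosed.splits _) fun z hz => ?_
    have hz0 : aeval z p = 0 := by
      rw [aeval_def, ← eval_map]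
      exact isRoot_of_mem_roots hz
    exact ⟨z.re, Complex.ext rfl (hreal z hz0).symm⟩
  have hnodup : p.roots.Nodup := by
    refine Multiset.nodup_iff_count_le_one.2 fun x => ?_
    rw [count_roots]
    by_contra! h
    have hp : p ≠ 0 := by
      rintro rfl
      simp at h
    obtain ⟨h0, h1⟩ := (one_lt_rootMultiplicity_iff_isRoot hp).1 h
    exact hsimple x h0 h1
  rw [Multiset.toFinset_card_of_nodup hnodup, hsplits.natDegree_eq_card_roots]

theorem aeval_complex_ofReal (p : ℝ[X]) (x : ℝ) : aeval (x : ℂ) p = ((p.eval x : ℝ) : ℂ) :=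
  aeval_ofReal p x

-- The bound at `x + it` becomes one on the derivative at `t = 0`: `Im (p conj q)` vanishes on `ℝ`.
theorem le_wronskian_of_le_im_mul_conj {p q : ℝ[X]} {c : ℝ}
    (h : ∀ z : ℂ, 0 < z.im → c * z.im ≤ (aeval z p * conj (aeval z q)).im) (x : ℝ) :
    c ≤ (derivative p).eval x * q.eval x - p.eval x * (derivative q).eval x := by
  let γ (t : ℝ) : ℂ := x + t * Complex.I
  have hγ : HasDerivAt γ Complex.I 0 :=
    (((hasDerivAt_id (0 : ℝ)).ofReal_comp.mul_const Complex.I).const_add (x : ℂ)).congr_deriv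
      (by simp)
  have hγ0 : γ 0 = x := by simp [γ]
  have hcomp (r : ℝ[X]) :
      HasDerivAt (fun t => aeval (γ t) r) (((derivative r).eval x : ℝ) * Complex.I) 0 := by
    have := (r.hasDerivAt_aeval (γ 0)).comp (0 : ℝ) hγ
    rwa [hγ0, aeval_complex_ofReal] at this
  have him : HasDerivAt (fun t => (aeval (γ t) p * conj (aeval (γ t) q)).im)
      ((derivative p).eval x * q.eval x - p.eval x * (derivative q).eval x) 0 := by
    have := Complex.imCLM.hasFDerivAt.comp_hasDerivAt (0 : ℝ) ((hcomp p).mul (hcomp q).star)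
    simpa [Function.comp_def, hγ0, aeval_complex_ofReal, sub_eq_add_neg] using this
  refine ge_of_tendsto him.tendsto_slope_zero_right ?_
  filter_upwards [self_mem_nhdsWithin] with t ht
  have ht : 0 < t := ht
  have hγt : (γ t).im = t := by simp [γ]
  have hle := h (γ t) (hγt.symm ▸ ht)
  rw [hγt] at hle
  simpa [hγ0, aeval_complex_ofReal, ← div_eq_inv_mul, le_div_iff₀ ht, ← sub_eq_neg_add] using hle

section Jet

variable {A B : Type*}

/-- Transports the jet `(f, f', f'')` of a quadratic polynomial over the distance `l`. -/
noncomputable def jetTranslate [AddCommMonoid A] [Module ℝ A] (l : ℝ) (v : Fin 3 → A) :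
    Fin 3 → A :=
  ![v 0 + l • v 1 + (l ^ 2 / 2) • v 2, v 1 + l • v 2, v 2]

/-- Changes the jet `(f, f', f'')` by the jump `m f` of `f''` at a point mass. -/
def jetKick [Semiring A] (m : A) (v : Fin 3 → A) : Fin 3 → A :=
  ![v 0, v 1, v 2 + m * v 0]

/-- The bilinear concomitant of `-f''' = z g f` and its adjoint, as a pairing of the jets of
two solutions. -/
def concomitant [Ring A] (u v : Fin 3 → A) : A :=
  u 2 * v 0 - u 1 * v 1 + u 0 * v 2

theorem jetTranslate_comp [CommSemiring A] [Algebra ℝ A] [CommSemiring B] [Algebra ℝ B]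
    (σ : A →ₐ[ℝ] B) (l : ℝ) (v : Fin 3 → A) : jetTranslate l (σ ∘ v) = σ ∘ jetTranslate l v := by
  ext j
  fin_cases j <;> simp [jetTranslate]

theorem jetKick_comp [Semiring A] [Semiring B] (σ : A →+* B) (m : A) (v : Fin 3 → A) :
    jetKick (σ m) (σ ∘ v) = σ ∘ jetKick m v := by
  ext j
  fin_cases j <;> simp [jetKick]

theorem jetTranslate_smul [CommSemiring A] [Algebra ℝ A] (l : ℝ) (r : A) (v : Fin 3 → A) :
    jetTranslate l (r • v) = r • jetTranslate l v := by
  ext j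
  fin_cases j <;> simp [jetTranslate, mul_add]

theorem jetKick_smul [CommSemiring A] (m r : A) (v : Fin 3 → A) :
    jetKick m (r • v) = r • jetKick m v := by
  ext j
  fin_cases j <;> simp [jetKick, mul_add, mul_left_comm]

theorem concomitant_jetTranslate [CommRing A] [Algebra ℝ A] (l : ℝ) (u v : Fin 3 → A) :
    concomitant (jetTranslate l u) (jetTranslate l v) = concomitant u v := by
  have hhalf : algebraMap ℝ A l ^ 2 = 2 * algebraMap ℝ A (l ^ 2 / 2) := by
    rw [← map_pow, ← map_ofNat (algebraMap ℝ A) 2, ← map_mul, mul_div_cancel₀ _ two_ne_zero]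
  simp only [concomitant, jetTranslate, Matrix.cons_val, Algebra.smul_def]
  linear_combination -u 2 * v 2 * hhalf

theorem concomitant_jetKick [CommRing A] (m m' : A) (u v : Fin 3 → A) :
    concomitant (jetKick m u) (jetKick m' v) = concomitant u v + (m + m') * (u 0 * v 0) := by
  simp only [concomitant, jetKick, Matrix.cons_val]
  ring

theorem degree_jetTranslate {l : ℝ} (hl : l ≠ 0) {v : Fin 3 → ℝ[X]}
    (h0 : (v 0).degree < (v 2).degree) (h1 : (v 1).degree < (v 2).degree) (j : Fin 3) :
    (jetTranslate l v j).degree = (v 2).degree := by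
  have hdeg {r : ℝ} (hr : r ≠ 0) (p : ℝ[X]) : (r • p).degree = p.degree := by
    rw [smul_eq_C_mul, degree_C_mul hr]
  fin_cases j
  · have h01 : (v 0 + l • v 1).degree < ((l ^ 2 / 2) • v 2).degree := by
      rw [hdeg (by positivity)]
      exact (degree_add_le _ _).trans_lt (max_lt h0 (by rwa [hdeg hl]))
    exact (degree_add_eq_right_of_degree_lt h01).trans (hdeg (by positivity) _)
  · exact (degree_add_eq_right_of_degree_lt (by rwa [hdeg hl])).trans (hdeg hl _)
  · rfl

end Jet

/-- For `c ≥ 0` and `Im ζ ≥ 0` this puts the rotated quotients `ζ D i / D j`, `i < j`, in the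
closed upper half-plane. The jets of the solutions satisfy it for `ζ = 1` and for `ζ = z`; the
lower bound `c Im ζ` is there to survive division by `Im z` as `z` approaches the real line. -/
def IsHerglotz (c : ℝ) (ζ : ℂ) (D : Fin 3 → ℂ) : Prop :=
  ∀ i j, i < j → c * ζ.im ≤ (ζ * (D i * conj (D j))).im

theorem forall_lt_fin_three {p : Fin 3 → Fin 3 → Prop} (h₀₁ : p 0 1) (h₀₂ : p 0 2)
    (h₁₂ : p 1 2) (i j : Fin 3) (hij : i < j) : p i j := by
  fin_cases i <;> fin_cases j <;> first | exact absurd hij (by decide) | assumption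

namespace IsHerglotz

variable {c : ℝ} {z ζ : ℂ} {D D' : Fin 3 → ℂ}

theorem of_add_nonneg (h : IsHerglotz c ζ D) {r₀₁ r₀₂ r₁₂ : ℝ}
    (h₀₁ : 0 ≤ r₀₁) (h₀₂ : 0 ≤ r₀₂) (h₁₂ : 0 ≤ r₁₂)
    (e₀₁ : (ζ * (D' 0 * conj (D' 1))).im = (ζ * (D 0 * conj (D 1))).im + r₀₁)
    (e₀₂ : (ζ * (D' 0 * conj (D' 2))).im = (ζ * (D 0 * conj (D 2))).im + r₀₂)
    (e₁₂ : (ζ * (D' 1 * conj (D' 2))).im = (ζ * (D 1 * conj (D 2))).im + r₁₂) :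
    IsHerglotz c ζ D' :=
  forall_lt_fin_three ((h 0 1 (by decide)).trans (by linarith))
    ((h 0 2 (by decide)).trans (by linarith)) ((h 1 2 (by decide)).trans (by linarith))

theorem jetTranslate_quadratic (hζ : 0 ≤ ζ.im) {l : ℝ} (hl : 0 ≤ l) (hl' : l ≤ 1) :
    IsHerglotz (l ^ 3 / 2) ζ (jetTranslate l ![0, 0, 1]) := by
  have hcube : l ^ 3 / 2 ≤ l ^ 2 / 2 := by
    gcongr ?_ / 2
    exact pow_le_pow_of_le_one hl hl' (by norm_num)
  have hsq : l ^ 2 / 2 ≤ l := by nlinarith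
  refine forall_lt_fin_three ?_ ?_ ?_ <;>
    simp only [jetTranslate, Matrix.cons_val, zero_add, smul_zero, add_zero, Complex.smul_re,
      Complex.smul_im, Complex.mul_im, Complex.mul_re, Complex.conj_re, Complex.conj_im,
      Complex.one_re, Complex.one_im, smul_eq_mul]
  · nlinarith
  · nlinarith
  · nlinarith

theorem im_mul_nonneg (h : IsHerglotz c ζ D) (hc : 0 ≤ c) (hζ : 0 ≤ ζ.im) {i j : Fin 3}
    (hij : i < j) : 0 ≤ (ζ * (D i * conj (D j))).im :=
  (mul_nonneg hc hζ).trans (h i j hij)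

theorem translate (h : IsHerglotz c ζ D) (hc : 0 ≤ c) (hζ : 0 ≤ ζ.im) {l : ℝ} (hl : 0 ≤ l) :
    IsHerglotz c ζ (jetTranslate l D) := by
  have h₀₂ := h.im_mul_nonneg hc hζ (i := 0) (j := 2) (by decide)
  have h₁₂ := h.im_mul_nonneg hc hζ (i := 1) (j := 2) (by decide)
  have hD₂ := Complex.normSq_nonneg (D 2)
  have hD₁₂ := Complex.normSq_nonneg (D 1 + (l / 2) • D 2)
  refine h.of_add_nonneg
    (r₀₁ := l * (ζ * (D 0 * conj (D 2))).im + l ^ 2 / 2 * (ζ * (D 1 * conj (D 2))).im +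
      ζ.im * (l * Complex.normSq (D 1 + (l / 2) • D 2) + l ^ 3 / 4 * Complex.normSq (D 2)))
    (r₀₂ := l * (ζ * (D 1 * conj (D 2))).im + ζ.im * (l ^ 2 / 2 * Complex.normSq (D 2)))
    (r₁₂ := ζ.im * (l * Complex.normSq (D 2)))
    (by positivity) (by positivity) (by positivity) ?_ ?_ ?_ <;>
  · simp only [jetTranslate, Matrix.cons_val, Complex.add_re, Complex.add_im, Complex.smul_re,
      Complex.smul_im, Complex.mul_re, Complex.mul_im, Complex.conj_re, Complex.conj_im,
      smul_eq_mul, Complex.normSq_apply]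
    ring

theorem kick_one (h : IsHerglotz c 1 D) (h' : IsHerglotz c z D) (hc : 0 ≤ c) (hz : 0 ≤ z.im)
    {m : ℝ} (hm : 0 ≤ m) : IsHerglotz c 1 (jetKick (-z * m) D) := by
  have h₀₁ := h'.im_mul_nonneg hc hz (i := 0) (j := 1) (by decide)
  have hD₀ := Complex.normSq_nonneg (D 0)
  refine h.of_add_nonneg (r₀₁ := 0) (r₀₂ := m * (z.im * Complex.normSq (D 0)))
    (r₁₂ := m * (z * (D 0 * conj (D 1))).im)
    le_rfl (by positivity) (by positivity) ?_ ?_ ?_ <;>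
  · simp only [jetKick, Matrix.cons_val, one_mul, Complex.add_re, Complex.add_im, Complex.neg_re,
      Complex.neg_im, Complex.mul_re, Complex.mul_im, Complex.conj_re, Complex.conj_im,
      Complex.ofReal_re, Complex.ofReal_im, Complex.normSq_apply]
    ring

theorem kick (h : IsHerglotz c z D) (h' : IsHerglotz c 1 D) {m : ℝ} (hm : 0 ≤ m) :
    IsHerglotz c z (jetKick (-z * m) D) := by
  have h₀₁ : 0 ≤ (D 0 * conj (D 1)).im := by simpa using h' 0 1 (by decide)
  have hz := Complex.normSq_nonneg z
  refine h.of_add_nonneg (r₀₁ := 0) (r₀₂ := 0)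
    (r₁₂ := m * Complex.normSq z * (D 0 * conj (D 1)).im)
    le_rfl le_rfl (by positivity) ?_ ?_ ?_ <;>
  · simp only [jetKick, Matrix.cons_val, Complex.add_re, Complex.add_im, Complex.neg_re,
      Complex.neg_im, Complex.mul_re, Complex.mul_im, Complex.conj_re, Complex.conj_im,
      Complex.ofReal_re, Complex.ofReal_im, Complex.normSq_apply]
    ring

end IsHerglotz

theorem eq_add_integral_of_eqOn {E : Type*} [NormedAddCommGroup E] [NormedSpace ℝ E]
    {f g p : ℝ → E} {o a b : ℝ} (hfa : f a = f o + ∫ t in o..a, g t)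
    (hfb : f b = f o + ∫ t in o..b, g t) (hg : IntervalIntegrable g volume o a)
    (hp : IntervalIntegrable p volume a b) (hgp : EqOn g p (uIoo a b)) :
    f b = f a + ∫ t in a..b, p t := by
  rw [hfa, hfb, ← intervalIntegral.integral_congr_uIoo hgp, add_assoc,
    intervalIntegral.integral_add_adjacent_intervals hg (hp.congr_uIoo hgp.symm)]

namespace DiscreteCubicString

/-- The endpoint `0`, followed by the positions of the masses and the endpoint `1`. -/
noncomputable def node (S : DiscreteCubicString) : ℕ → ℝ
  | 0 => 0
  | k + 1 => if h : k < S.n then S.pos ⟨k, h⟩ else 1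

/-- The mass at `S.node (k + 1)`, with an additional zero mass at the endpoint `1`. -/
noncomputable def weight (S : DiscreteCubicString) (k : ℕ) : ℝ :=
  if h : k < S.n then S.wt ⟨k, h⟩ else 0

/-- The distance between the consecutive nodes `S.node k` and `S.node (k + 1)`. -/
noncomputable def gap (S : DiscreteCubicString) (k : ℕ) : ℝ := S.node (k + 1) - S.node k

variable (S : DiscreteCubicString)

theorem node_zero : S.node 0 = 0 := rfl

theorem node_succ (i : Fin S.n) : S.node (i + 1) = S.pos i := by simp [node]

theorem node_last : S.node (S.n + 1) = 1 := by simp [node]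

theorem weight_coe (i : Fin S.n) : S.weight i = S.wt i := by simp [weight]

theorem weight_pos {k : ℕ} (hk : k < S.n) : 0 < S.weight k := by
  simp [weight, hk, S.wt_pos]

theorem weight_of_le {k : ℕ} (hk : S.n ≤ k) : S.weight k = 0 := by
  simp [weight, hk.not_gt]

theorem weight_nonneg (k : ℕ) : 0 ≤ S.weight k := by
  rcases lt_or_ge k S.n with hk | hk
  exacts [(S.weight_pos hk).le, (S.weight_of_le hk).ge]

theorem gap_pos {k : ℕ} (hk : k < S.n) : 0 < S.gap k := by
  cases k with
  | zero => simpa [gap, node, hk] using S.pos_pos _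
  | succ k =>
    have h : k < S.n := by omega
    simpa [gap, node, hk, h] using S.strictMono_pos (Fin.mk_lt_mk.2 (Nat.lt_succ_self k))

theorem gap_nonneg (k : ℕ) : 0 ≤ S.gap k := by
  rcases lt_or_ge k S.n with hk | hk
  · exact (S.gap_pos hk).le
  · cases k with
    | zero => simp [gap, node, hk.not_gt]
    | succ k =>
      have h : ¬ k + 1 < S.n := by omega
      by_cases h' : k < S.n
      · simpa [gap, node, h, h'] using S.pos_le_one _
      · simp [gap, node, h, h']

theorem gap_zero_pos : 0 < S.gap 0 := by
  by_cases h : 0 < S.n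
  · exact S.gap_pos h
  · simp [gap, node, h]

theorem gap_last_pos (hS : S.Nondegenerate) : 0 < S.gap S.n := by
  rcases S.n.eq_zero_or_pos with h | h
  · rw [h]
    exact S.gap_zero_pos
  · obtain ⟨k, hk⟩ := Nat.exists_eq_add_one.2 h
    have h' : k < S.n := by omega
    rw [gap, node_last, sub_pos, hk]
    simpa [node, h'] using hS ⟨k, h'⟩

theorem monotone_node : Monotone S.node :=
  monotone_nat_of_le_succ fun k => sub_nonneg.1 (S.gap_nonneg k)

theorem node_mem_Icc {k : ℕ} (hk : k ≤ S.n + 1) : S.node k ∈ Icc (0 : ℝ) 1 :=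
  ⟨S.monotone_node k.zero_le, S.node_last ▸ S.monotone_node hk⟩

theorem pos_le_node_iff {k : ℕ} (i : Fin S.n) : S.pos i ≤ S.node k ↔ (i : ℕ) < k := by
  rw [← S.node_succ]
  refine ⟨fun h => ?_, fun h => S.monotone_node h⟩
  by_contra! hki
  have hgap : 0 < S.node (i + 1) - S.node i := S.gap_pos i.2
  linarith [S.monotone_node hki]

theorem pos_le_iff_of_mem_Ico {k : ℕ} {x : ℝ} (hx : x ∈ Ico (S.node k) (S.node (k + 1)))
    (i : Fin S.n) : S.pos i ≤ x ↔ (i : ℕ) < k := by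
  refine ⟨fun h => ?_, fun h => ((S.pos_le_node_iff i).2 h).trans hx.1⟩
  have : (i : ℕ) < k + 1 := (S.pos_le_node_iff i).1 (h.trans hx.2.le)
  have : (i : ℕ) ≠ k := by
    rintro rfl
    exact (h.trans_lt hx.2).ne (S.node_succ i).symm
  omega

theorem setIntegral_mass_eq_sum_range (f : ℝ → ℂ) {k : ℕ} {x : ℝ}
    (hx : ∀ i, S.pos i ≤ x ↔ (i : ℕ) < k) :
    ∫ t in Ioc (0 : ℝ) x, f t ∂S.mass =
      ∑ i ∈ Finset.range k, (S.weight i : ℂ) * f (S.node (i + 1)) := by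
  have hrange : ∀ i ∈ Finset.range k, i ∉ (Finset.range S.n).filter (· < k) →
      (S.weight i : ℂ) * f (S.node (i + 1)) = 0 := fun i hi hi' => by
    have : S.n ≤ i := by
      simp only [Finset.mem_range, Finset.mem_filter] at hi hi'
      omega
    rw [S.weight_of_le this, Complex.ofReal_zero, zero_mul]
  rw [S.setIntegral_mass, ← Finset.sum_subset (fun i => by simp) hrange, Finset.sum_filter,
    Finset.sum_range]
  simp only [hx, weight_coe, node_succ]

theorem form_eq_sum (f h : ℝ → ℂ) :
    S.form f h = ∑ i, (S.wt i : ℂ) * (f (S.pos i) * h (S.pos i)) := by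
  rw [form, mass, ← Measure.sum_fintype,
    integral_sum_ofReal_smul_dirac (fun i => (S.wt_pos i).le)]

/-- The values `(f, f_ξ, f_{ξξ})(x)` of a solution, in the form taken by `jetTranslate` and
`jetKick`. -/
def jet (F : Fin 3 → ℝ → ℂ) (x : ℝ) : Fin 3 → ℂ := fun j => F j x

variable {S} {c d : ℂ} {F G : Fin 3 → ℝ → ℂ}

theorem IsSolution.two_eqOn (hF : S.IsSolution c F) {k : ℕ} (hk : k ≤ S.n) :
    EqOn (F 2) (fun _ => F 2 (S.node k)) (Ico (S.node k) (S.node (k + 1))) := fun x hx => by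
  have hk0 := S.node_mem_Icc (k := k) (by omega)
  have hk1 := S.node_mem_Icc (k := k + 1) (by omega)
  dsimp only
  rw [hF.eq_two x ⟨hk0.1.trans hx.1, hx.2.le.trans hk1.2⟩, hF.eq_two _ hk0,
    S.setIntegral_mass_eq_sum_range _ (S.pos_le_iff_of_mem_Ico hx),
    S.setIntegral_mass_eq_sum_range _ S.pos_le_node_iff]

theorem intervalIntegrable_of_eqOn_Ioo_node {E : Type*} [NormedAddCommGroup E] {f : ℝ → E}
    {p : ℕ → ℝ → E} (hp : ∀ k, Continuous (p k)) {m : ℕ}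
    (hfp : ∀ k < m, EqOn f (p k) (Ioo (S.node k) (S.node (k + 1)))) :
    IntervalIntegrable f volume 0 (S.node m) :=
  IntervalIntegrable.trans_iterate fun k hk =>
    ((hp k).intervalIntegrable _ _).congr_uIoo <| by
      rw [uIoo_of_le (S.monotone_node k.le_succ)]
      exact (hfp k hk).symm

theorem IsSolution.one_eqOn (hF : S.IsSolution c F) {k : ℕ} (hk : k ≤ S.n) :
    EqOn (F 1) (fun x => F 1 (S.node k) + (x - S.node k) • F 2 (S.node k))
      (Icc (S.node k) (S.node (k + 1))) := fun x hx => by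
  have hk0 := S.node_mem_Icc (k := k) (by omega)
  have hk1 := S.node_mem_Icc (k := k + 1) (by omega)
  have hint : IntervalIntegrable (F 2) volume 0 (S.node k) :=
    intervalIntegrable_of_eqOn_Ioo_node (fun _ => continuous_const) fun j hj =>
      (hF.two_eqOn (hj.le.trans hk)).mono Ioo_subset_Ico_self
  have h := eq_add_integral_of_eqOn (hF.eq_one _ hk0)
    (hF.eq_one x ⟨hk0.1.trans hx.1, hx.2.trans hk1.2⟩) hint
    (continuous_const.intervalIntegrable _ _) ((hF.two_eqOn hk).mono <| by
      rw [uIoo_of_le hx.1]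
      exact Ioo_subset_Ico_self.trans (Ico_subset_Ico_right hx.2))
  rwa [intervalIntegral.integral_const] at h

theorem IsSolution.zero_eqOn (hF : S.IsSolution c F) {k : ℕ} (hk : k ≤ S.n) :
    EqOn (F 0) (fun x => F 0 (S.node k) + (x - S.node k) • F 1 (S.node k) +
      ((x - S.node k) ^ 2 / 2) • F 2 (S.node k)) (Icc (S.node k) (S.node (k + 1))) :=
    fun x hx => by
  have hk0 := S.node_mem_Icc (k := k) (by omega)
  have hk1 := S.node_mem_Icc (k := k + 1) (by omega)
  have hcont (j : ℕ) : Continuous fun x : ℝ =>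
      F 1 (S.node j) + (x - S.node j) • F 2 (S.node j) := by fun_prop
  have hint : IntervalIntegrable (F 1) volume 0 (S.node k) :=
    intervalIntegrable_of_eqOn_Ioo_node hcont fun j hj =>
      (hF.one_eqOn (hj.le.trans hk)).mono Ioo_subset_Icc_self
  have h := eq_add_integral_of_eqOn (hF.eq_zero _ hk0)
    (hF.eq_zero x ⟨hk0.1.trans hx.1, hx.2.trans hk1.2⟩) hint
    ((hcont k).intervalIntegrable _ _) ((hF.one_eqOn hk).mono <| by
      rw [uIoo_of_le hx.1]
      exact Ioo_subset_Icc_self.trans (Icc_subset_Icc_right hx.2))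
  have hlin : ∫ t in S.node k..x, (t - S.node k) = (x - S.node k) ^ 2 / 2 := by
    simp [intervalIntegral.integral_comp_sub_right fun t => t]
  rw [intervalIntegral.integral_add (continuous_const.intervalIntegrable _ _)
    (Continuous.intervalIntegrable (by fun_prop) _ _), intervalIntegral.integral_const,
    intervalIntegral.integral_smul_const, hlin, ← add_assoc] at h
  exact h

theorem IsSolution.two_node_succ (hF : S.IsSolution c F) {k : ℕ} (hk : k ≤ S.n) :
    F 2 (S.node (k + 1)) = F 2 (S.node k) + c * S.weight k * F 0 (S.node (k + 1)) := by
  rw [hF.eq_two _ (S.node_mem_Icc (by omega)), hF.eq_two _ (S.node_mem_Icc (by omega)),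
    S.setIntegral_mass_eq_sum_range _ S.pos_le_node_iff,
    S.setIntegral_mass_eq_sum_range _ S.pos_le_node_iff, Finset.sum_range_succ]
  ring

theorem IsSolution.jet_node_succ (hF : S.IsSolution c F) {k : ℕ} (hk : k ≤ S.n) :
    jet F (S.node (k + 1)) =
      jetKick (c * S.weight k) (jetTranslate (S.gap k) (jet F (S.node k))) := by
  have hmem : S.node (k + 1) ∈ Icc (S.node k) (S.node (k + 1)) :=
    right_mem_Icc.2 (S.monotone_node k.le_succ)
  have h0 := hF.zero_eqOn hk hmem
  ext j
  fin_cases j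
  · exact h0
  · exact hF.one_eqOn hk hmem
  · refine (hF.two_node_succ hk).trans ?_
    rw [h0]
    rfl

theorem IsSolution.lagrange_identity (hF : S.IsSolution c F) (hG : S.IsSolution d G) :
    concomitant (jet F 1) (jet G 1) - concomitant (jet F 0) (jet G 0) =
      (c + d) * S.form (F 0) (G 0) := by
  have hnode : ∀ k ≤ S.n + 1, concomitant (jet F (S.node k)) (jet G (S.node k)) =
      concomitant (jet F 0) (jet G 0) + (c + d) *
        ∑ i ∈ Finset.range k, S.weight i * (F 0 (S.node (i + 1)) * G 0 (S.node (i + 1))) := by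
    intro k hk
    induction k with
    | zero => simp [node_zero]
    | succ k ih =>
      have hk' : k ≤ S.n := by omega
      have hF0 : F 0 (S.node (k + 1)) = jetTranslate (S.gap k) (jet F (S.node k)) 0 :=
        congrFun (hF.jet_node_succ hk') 0
      have hG0 : G 0 (S.node (k + 1)) = jetTranslate (S.gap k) (jet G (S.node k)) 0 :=
        congrFun (hG.jet_node_succ hk') 0
      rw [hF.jet_node_succ hk', hG.jet_node_succ hk', concomitant_jetKick,
        concomitant_jetTranslate, ih (by omega), Finset.sum_range_succ, hF0, hG0]
      ring
  have h1 := hnode _ le_rfl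
  rw [node_last, Finset.sum_range_succ, S.weight_of_le le_rfl, Finset.sum_range] at h1
  simp only [node_succ, weight_coe] at h1
  rw [h1, form_eq_sum]
  simp

/-! ### The characteristic polynomials -/

theorem IsSolution.eqOn_zero (hF : S.IsSolution c F) (h : jet F 0 = 0) :
    EqOn (F 0) 0 (Icc 0 1) := by
  have hnode : ∀ k ≤ S.n + 1, jet F (S.node k) = 0 := fun k => by
    induction k with
    | zero => exact fun _ => h
    | succ k ih =>
      intro hk
      rw [hF.jet_node_succ (by omega), ih (by omega), ← zero_smul ℂ (0 : Fin 3 → ℂ),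
        jetTranslate_smul, jetKick_smul, zero_smul, zero_smul]
  have hpos (i : Fin S.n) : F 0 (S.pos i) = 0 := by
    rw [← S.node_succ]
    exact congrFun (hnode (i + 1) (by omega)) 0
  have h2 : EqOn (F 2) 0 (Icc 0 1) := fun x hx => by
    rw [hF.eq_two x hx, S.setIntegral_mass, show F 2 0 = 0 from congrFun h 2]
    simp [hpos]
  have h1 : EqOn (F 1) 0 (Icc 0 1) := fun x hx => by
    rw [hF.eq_one x hx, show F 1 0 = 0 from congrFun h 1, zero_add,
      intervalIntegral.integral_congr (h2.mono (uIcc_subset_Icc (by simp) hx))]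
    simp
  intro x hx
  rw [hF.eq_zero x hx, show F 0 0 = 0 from congrFun h 0, zero_add,
    intervalIntegral.integral_congr (h1.mono (uIcc_subset_Icc (by simp) hx))]
  simp

/-- The jet of `φ(·; z)` at `S.node k`, as polynomials in `z`. -/
noncomputable def jetPoly (S : DiscreteCubicString) : ℕ → Fin 3 → ℝ[X]
  | 0 => ![0, 0, 1]
  | k + 1 => jetKick (-X * C (S.weight k)) (jetTranslate (S.gap k) (jetPoly S k))

/-- The polynomials in `z` with values `φ(1; z)`, `φ_ξ(1; z)`, `φ_{ξξ}(1; z)`, whose roots form the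
spectra of types `0`, `1`, `2`. -/
noncomputable def charPoly (S : DiscreteCubicString) : Fin 3 → ℝ[X] := S.jetPoly (S.n + 1)

theorem aeval_jetPoly_succ (z : ℂ) (k : ℕ) :
    aeval z ∘ S.jetPoly (k + 1) =
      jetKick (-z * S.weight k) (jetTranslate (S.gap k) (aeval z ∘ S.jetPoly k)) := by
  have hkick : -z * S.weight k = aeval z (-X * C (S.weight k)) := by
    simp only [map_mul, map_neg, aeval_X, aeval_C, Complex.coe_algebraMap]
  rw [hkick, jetTranslate_comp]
  exact (jetKick_comp (aeval z : ℝ[X] →ₐ[ℝ] ℂ).toRingHom _ _).symm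

theorem IsSolution.jet_node {z : ℂ} (hF : S.IsSolution (-z) F) (h0 : F 0 0 = 0) (h1 : F 1 0 = 0)
    {k : ℕ} (hk : k ≤ S.n + 1) : jet F (S.node k) = F 2 0 • (aeval z ∘ S.jetPoly k) := by
  induction k with
  | zero =>
    ext j
    fin_cases j <;> simp [jet, node, jetPoly, h0, h1]
  | succ k ih =>
    rw [hF.jet_node_succ (by omega), ih (by omega), aeval_jetPoly_succ, jetTranslate_smul,
      jetKick_smul]

variable (S)

theorem jet_phi_node (z : ℂ) {k : ℕ} (hk : k ≤ S.n + 1) :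
    jet (S.phi z) (S.node k) = aeval z ∘ S.jetPoly k := by
  obtain ⟨hφ, hφ0⟩ := S.phi_spec z
  rw [hφ.jet_node (hφ0 0) (hφ0 1) hk, hφ0 2]
  exact one_smul _ _

theorem jet_phi_one (z : ℂ) : jet (S.phi z) 1 = aeval z ∘ S.charPoly := by
  rw [← S.node_last, S.jet_phi_node z le_rfl, charPoly]

theorem phi_one (z : ℂ) (a : Fin 3) : S.phi z a 1 = aeval z (S.charPoly a) :=
  congrFun (S.jet_phi_one z) a

theorem phi_pos (z : ℂ) (i : Fin S.n) : S.phi z 0 (S.pos i) = aeval z (S.jetPoly (i + 1) 0) := by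
  rw [← S.node_succ]
  exact congrFun (S.jet_phi_node z (by omega)) 0

theorem mem_spectrum_iff {z : ℂ} {a : Fin 3} : z ∈ S.spectrum a ↔ aeval z (S.charPoly a) = 0 := by
  constructor
  · rintro ⟨F, hF, h0, h1, ha, x, hx, hFx⟩
    have hFa : F a 1 = F 2 0 * aeval z (S.charPoly a) := by
      rw [← S.node_last]
      exact congrFun (hF.jet_node h0 h1 le_rfl) a
    have h2 : F 2 0 ≠ 0 := fun h2 => hFx <| hF.eqOn_zero (by ext j; fin_cases j <;> assumption) hx
    exact (mul_eq_zero.1 (hFa.symm.trans ha)).resolve_left h2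
  · intro hz
    obtain ⟨hφ, hφ0⟩ := S.phi_spec z
    have hfirst : S.phi z 0 (S.node 1) = (S.gap 0 ^ 2 / 2 : ℝ) :=
      (congrFun (S.jet_phi_node z (by omega)) 0).trans <| by
        simp [jetPoly, jetKick, jetTranslate]
    refine ⟨S.phi z, hφ, hφ0 0, hφ0 1, (S.phi_one z a).trans hz, S.node 1,
      S.node_mem_Icc (by omega), ?_⟩
    rw [hfirst, Complex.ofReal_ne_zero]
    have := S.gap_zero_pos
    positivity

theorem degree_jetPoly {k : ℕ} (hk : k ≤ S.n) :
    (S.jetPoly k 0).degree < k ∧ (S.jetPoly k 1).degree < k ∧ (S.jetPoly k 2).degree = k := by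
  induction k with
  | zero => simp [jetPoly]
  | succ k ih =>
    obtain ⟨h0, h1, h2⟩ := ih (by omega)
    have hdeg (j : Fin 3) : (jetTranslate (S.gap k) (S.jetPoly k) j).degree = k := by
      rw [degree_jetTranslate (S.gap_pos hk).ne' (by rwa [h2]) (by rwa [h2]), h2]
    have hlt : (k : WithBot ℕ) < (k + 1 : ℕ) := by exact_mod_cast k.lt_succ_self
    refine ⟨(hdeg 0).trans_lt hlt, (hdeg 1).trans_lt hlt, ?_⟩
    have hkick : (-X * C (S.weight k) * jetTranslate (S.gap k) (S.jetPoly k) 0).degree =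
        ((k + 1 : ℕ) : WithBot ℕ) := by
      rw [degree_mul, degree_mul, degree_neg, degree_X, degree_C (S.weight_pos hk).ne', hdeg,
        add_zero, add_comm, Nat.cast_succ]
    exact (degree_add_eq_right_of_degree_lt (by rwa [hkick, hdeg])).trans hkick

theorem charPoly_eq_jetTranslate : S.charPoly = jetTranslate (S.gap S.n) (S.jetPoly S.n) := by
  rw [charPoly, jetPoly, S.weight_of_le le_rfl]
  ext j : 1
  fin_cases j <;> simp [jetKick]

theorem natDegree_charPoly {a : Fin 3} (ha : S.Nondegenerate ∨ a = 2) :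
    (S.charPoly a).natDegree = S.n := by
  obtain ⟨h0, h1, h2⟩ := S.degree_jetPoly le_rfl
  rw [charPoly_eq_jetTranslate]
  apply natDegree_eq_of_degree_eq_some
  rcases ha with hS | rfl
  · rw [degree_jetTranslate (S.gap_last_pos hS).ne' (by rwa [h2]) (by rwa [h2]), h2]
  · exact h2

/-! ### Positivity of eigenvalues and residues -/

theorem isHerglotz_jetPoly {z : ℂ} (hz : 0 < z.im) (k : ℕ) :
    IsHerglotz (S.gap 0 ^ 3 / 2) 1 (aeval z ∘ S.jetPoly (k + 1)) ∧
      IsHerglotz (S.gap 0 ^ 3 / 2) z (aeval z ∘ S.jetPoly (k + 1)) := by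
  have hgap := S.gap_zero_pos
  have hc : 0 ≤ S.gap 0 ^ 3 / 2 := by positivity
  have hkick {v : Fin 3 → ℂ} (k : ℕ)
      (hv : IsHerglotz (S.gap 0 ^ 3 / 2) 1 v ∧ IsHerglotz (S.gap 0 ^ 3 / 2) z v) :
      IsHerglotz (S.gap 0 ^ 3 / 2) 1 (jetKick (-z * S.weight k) v) ∧
        IsHerglotz (S.gap 0 ^ 3 / 2) z (jetKick (-z * S.weight k) v) :=
    ⟨hv.1.kick_one hv.2 hc hz.le (S.weight_nonneg k), hv.2.kick hv.1 (S.weight_nonneg k)⟩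
  induction k with
  | zero =>
    have hjet : aeval z ∘ S.jetPoly 0 = ![0, 0, 1] := by
      ext j
      fin_cases j <;> simp [jetPoly]
    have hle : S.gap 0 ≤ 1 := by
      simpa [gap, node_zero] using (S.node_mem_Icc (k := 1) (by omega)).2
    rw [aeval_jetPoly_succ, hjet]
    exact hkick 0 ⟨.jetTranslate_quadratic (by simp) hgap.le hle,
      .jetTranslate_quadratic hz.le hgap.le hle⟩
  | succ k ih =>
    rw [aeval_jetPoly_succ]
    exact hkick _ ⟨ih.1.translate hc (by simp) (S.gap_nonneg _),
      ih.2.translate hc hz.le (S.gap_nonneg _)⟩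

theorem isHerglotz_charPoly {z : ℂ} (hz : 0 < z.im) :
    IsHerglotz (S.gap 0 ^ 3 / 2) 1 (aeval z ∘ S.charPoly) ∧
      IsHerglotz (S.gap 0 ^ 3 / 2) z (aeval z ∘ S.charPoly) :=
  S.isHerglotz_jetPoly hz S.n

theorem aeval_charPoly_ne_zero {z : ℂ} (hz : 0 < z.im) (a : Fin 3) :
    aeval z (S.charPoly a) ≠ 0 := by
  have hc : 0 < S.gap 0 ^ 3 / 2 * z.im := by
    have := S.gap_zero_pos
    positivity
  have hpos {i j : Fin 3} (hij : i < j) :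
      aeval z (S.charPoly i) ≠ 0 ∧ aeval z (S.charPoly j) ≠ 0 := by
    refine ⟨fun h => ?_, fun h => ?_⟩ <;>
      simpa [h] using hc.trans_le ((S.isHerglotz_charPoly hz).2 i j hij)
  fin_cases a
  · exact (hpos (j := 1) (by decide)).1
  · exact (hpos (i := 0) (by decide)).2
  · exact (hpos (i := 0) (by decide)).2

theorem charPoly_ne_zero (a : Fin 3) : S.charPoly a ≠ 0 := fun h =>
  S.aeval_charPoly_ne_zero (z := Complex.I) (by simp) a (by rw [h, map_zero])

theorem im_eq_zero_of_aeval_charPoly {z : ℂ} {a : Fin 3} (h : aeval z (S.charPoly a) = 0) :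
    z.im = 0 := by
  rcases lt_trichotomy z.im 0 with hz | hz | hz
  · have hconj : aeval (conj z) (S.charPoly a) = 0 := by rw [aeval_conj, h, map_zero]
    exact absurd hconj (S.aeval_charPoly_ne_zero (by simpa using hz) a)
  · exact hz
  · exact absurd h (S.aeval_charPoly_ne_zero hz a)

theorem wronskian_charPoly_nonneg {i j : Fin 3} (hij : i < j) (x : ℝ) :
    0 ≤ (derivative (S.charPoly i)).eval x * (S.charPoly j).eval x -
      (S.charPoly i).eval x * (derivative (S.charPoly j)).eval x := by
  refine le_wronskian_of_le_im_mul_conj (fun z hz => ?_) x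
  have h := (S.isHerglotz_charPoly hz).1 i j hij
  rwa [Complex.one_im, mul_zero, one_mul, ← zero_mul z.im] at h

theorem wronskian_X_mul_charPoly_pos {i j : Fin 3} (hij : i < j) (x : ℝ) :
    0 < (S.charPoly i).eval x * (S.charPoly j).eval x +
      x * ((derivative (S.charPoly i)).eval x * (S.charPoly j).eval x -
        (S.charPoly i).eval x * (derivative (S.charPoly j)).eval x) := by
  have hgap := S.gap_zero_pos
  have h := le_wronskian_of_le_im_mul_conj (p := X * S.charPoly i) (q := S.charPoly j)
    (c := S.gap 0 ^ 3 / 2) (fun z hz => by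
      rw [map_mul, aeval_X, mul_assoc z]
      exact (S.isHerglotz_charPoly hz).2 i j hij) x
  simp only [derivative_mul, derivative_X, eval_add, eval_mul, eval_X, one_mul] at h
  exact (by positivity : 0 < S.gap 0 ^ 3 / 2).trans_le (h.trans_eq (by ring))

theorem pos_and_div_derivative_pos_of_lt {i j : Fin 3} (hij : i < j) {x : ℝ}
    (hx : (S.charPoly i).eval x = 0) :
    0 < x ∧ 0 < (S.charPoly j).eval x / (derivative (S.charPoly i)).eval x := by
  have h₁ := S.wronskian_charPoly_nonneg hij x
  have h₂ := S.wronskian_X_mul_charPoly_pos hij x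
  rw [hx, zero_mul, zero_add, zero_mul, sub_zero, mul_comm (eval _ _)] at h₂
  rw [hx, zero_mul, sub_zero, mul_comm] at h₁
  rw [div_pos_iff, ← mul_pos_iff]
  exact (pos_and_pos_or_neg_and_neg_of_mul_pos h₂).resolve_right fun h => h.2.not_ge h₁

theorem pos_and_div_derivative_pos_of_gt {i j : Fin 3} (hij : i < j) {x : ℝ}
    (hx : (S.charPoly j).eval x = 0) :
    0 < x ∧ 0 < -(S.charPoly i).eval x / (derivative (S.charPoly j)).eval x := by
  have h₁ := S.wronskian_charPoly_nonneg hij x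
  have h₂ := S.wronskian_X_mul_charPoly_pos hij x
  rw [hx, mul_zero, zero_add, mul_zero, zero_sub, ← neg_mul] at h₂
  rw [hx, mul_zero, zero_sub, ← neg_mul] at h₁
  rw [div_pos_iff, ← mul_pos_iff]
  exact (pos_and_pos_or_neg_and_neg_of_mul_pos h₂).resolve_right fun h => h.2.not_ge h₁

theorem pos_and_derivative_ne_zero {a : Fin 3} {x : ℝ} (hx : (S.charPoly a).eval x = 0) :
    0 < x ∧ (derivative (S.charPoly a)).eval x ≠ 0 := by
  have hlt {j : Fin 3} (haj : a < j) := S.pos_and_div_derivative_pos_of_lt haj hx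
  have hgt {i : Fin 3} (hia : i < a) := S.pos_and_div_derivative_pos_of_gt hia hx
  fin_cases a
  · exact (hlt (j := 1) (by decide)).imp_right fun h => (div_ne_zero_iff.1 h.ne').2
  · exact (hlt (j := 2) (by decide)).imp_right fun h => (div_ne_zero_iff.1 h.ne').2
  · exact (hgt (i := 0) (by decide)).imp_right fun h => (div_ne_zero_iff.1 h.ne').2

theorem ofReal_mem_spectrum_iff {a : Fin 3} {x : ℝ} :
    (x : ℂ) ∈ S.spectrum a ↔ (S.charPoly a).eval x = 0 := by
  rw [mem_spectrum_iff, aeval_complex_ofReal, Complex.ofReal_eq_zero]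

theorem exists_ofReal_eq_of_mem_spectrum {a : Fin 3} {z : ℂ} (hz : z ∈ S.spectrum a) :
    ∃ x : ℝ, (x : ℂ) = z ∧ (S.charPoly a).eval x = 0 := by
  have him : z.im = 0 := S.im_eq_zero_of_aeval_charPoly (S.mem_spectrum_iff.1 hz)
  refine ⟨z.re, Complex.ext rfl him.symm, ?_⟩
  rwa [← ofReal_mem_spectrum_iff, show (z.re : ℂ) = z from Complex.ext rfl him.symm]

/-- The real points of the spectrum of type `a`, as an index type. -/
abbrev Eigenvalue (S : DiscreteCubicString) (a : Fin 3) : Type :=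
  {x : ℝ // (x : ℂ) ∈ S.spectrum a}

theorem mem_roots_charPoly_iff {a : Fin 3} (x : ℝ) :
    x ∈ (S.charPoly a).roots.toFinset ↔ (x : ℂ) ∈ S.spectrum a := by
  rw [Multiset.mem_toFinset, mem_roots (S.charPoly_ne_zero a), IsRoot, ofReal_mem_spectrum_iff]

noncomputable instance (a : Fin 3) : Fintype (S.Eigenvalue a) :=
  Fintype.subtype (S.charPoly a).roots.toFinset S.mem_roots_charPoly_iff

theorem card_eigenvalue {a : Fin 3} (ha : S.Nondegenerate ∨ a = 2) :
    Fintype.card (S.Eigenvalue a) = S.n := by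
  rw [Fintype.card_of_subtype _ S.mem_roots_charPoly_iff,
    card_roots_toFinset_of_complex_roots_real (fun _ => S.im_eq_zero_of_aeval_charPoly)
      (fun _ hx => (S.pos_and_derivative_ne_zero hx).2), S.natDegree_charPoly ha]

theorem finite_spectrum (a : Fin 3) : (S.spectrum a).Finite :=
  (Set.finite_range fun x : S.Eigenvalue a => (x : ℂ)).subset fun _ hz => by
    obtain ⟨x, rfl, -⟩ := S.exists_ofReal_eq_of_mem_spectrum hz
    exact ⟨⟨x, hz⟩, rfl⟩

variable {S} in
theorem Eigenvalue.eval_derivative_ne_zero {a : Fin 3} (x : S.Eigenvalue a) :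
    (derivative (S.charPoly a)).eval x.1 ≠ 0 :=
  (S.pos_and_derivative_ne_zero (S.ofReal_mem_spectrum_iff.1 x.2)).2

section Residue

variable {S} {a : Fin 3} {p : ℝ[X]}

theorem tendsto_residue (x : S.Eigenvalue a) :
    Tendsto (fun w : ℂ => (w - x.1) * (aeval w p / aeval w (S.charPoly a))) (𝓝[≠] (x.1 : ℂ))
      (𝓝 ((p.eval x.1 / (derivative (S.charPoly a)).eval x.1 : ℝ) : ℂ)) := by
  have hd : aeval (x.1 : ℂ) (derivative (S.charPoly a)) ≠ 0 := by
    rw [aeval_complex_ofReal, Complex.ofReal_ne_zero]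
    exact x.eval_derivative_ne_zero
  rw [Complex.ofReal_div, ← aeval_complex_ofReal, ← aeval_complex_ofReal]
  exact tendsto_sub_mul_div_of_simple_zero p.continuous_aeval.continuousAt
    ((S.charPoly a).hasDerivAt_aeval _) (S.mem_spectrum_iff.1 x.2) hd

theorem positiveSimplePoles_of_residue_pos
    (hp : ∀ x : S.Eigenvalue a, 0 < p.eval x.1 / (derivative (S.charPoly a)).eval x.1) :
    S.PositiveSimplePoles a fun w : ℂ => aeval w p / aeval w (S.charPoly a) := by
  refine ⟨S.finite_spectrum a, fun z hz => ?_⟩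
  obtain ⟨x, rfl, hx⟩ := S.exists_ofReal_eq_of_mem_spectrum hz
  exact ⟨x, _, (S.pos_and_derivative_ne_zero hx).1, hp ⟨x, hz⟩, rfl, tendsto_residue ⟨x, hz⟩⟩

theorem integral_spectralMeasure
    (hp : ∀ x : S.Eigenvalue a, 0 < p.eval x.1 / (derivative (S.charPoly a)).eval x.1)
    (f : ℝ → ℂ) :
    ∫ x, f x ∂S.spectralMeasure a (fun w : ℂ => aeval w p / aeval w (S.charPoly a)) =
      ∑ x : S.Eigenvalue a,
        ((p.eval x.1 / (derivative (S.charPoly a)).eval x.1 : ℝ) : ℂ) * f x.1 := by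
  have hres (x : S.Eigenvalue a) :
      (residue (fun w : ℂ => aeval w p / aeval w (S.charPoly a)) x.1).re =
        p.eval x.1 / (derivative (S.charPoly a)).eval x.1 := by
    rw [residue, (tendsto_residue x).limUnder_eq, Complex.ofReal_re]
  simp only [spectralMeasure, hres]
  exact integral_sum_ofReal_smul_dirac (fun x => (hp x).le) _ _

end Residue

/-! ### Biorthogonality and expansion in eigenfunctions -/

theorem fourier_eq_form (a : Fin 3) (f : ℝ → ℂ) (z : ℂ) :
    S.fourier a f z = (-1) ^ (a : ℕ) * S.form (S.phiStar a z 0) f := rfl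

theorem fourier_eq_sum (a : Fin 3) (f : ℝ → ℂ) (z : ℂ) :
    S.fourier a f z =
      ∑ i, (-1) ^ (a : ℕ) * S.wt i * S.phiStar a z 0 (S.pos i) * f (S.pos i) := by
  rw [fourier_eq_form, form_eq_sum, Finset.mul_sum]
  exact Finset.sum_congr rfl fun i _ => by ring

theorem form_comm (f h : ℝ → ℂ) : S.form f h = S.form h f := by
  simp only [form, mul_comm]

theorem concomitant_phi_phiStar_zero (a : Fin 3) (z w : ℂ) :
    concomitant (jet (S.phi z) 0) (jet (S.phiStar a w) 0) = S.phiStar a w 0 0 := by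
  simp [concomitant, jet, (S.phi_spec z).2]

theorem concomitant_phi_phiStar_one (a : Fin 3) (z w : ℂ) :
    concomitant (jet (S.phi z) 1) (jet (S.phiStar a w) 1) =
      (-1) ^ (a : ℕ) * aeval z (S.charPoly a) := by
  obtain rfl | rfl | rfl : a = 0 ∨ a = 1 ∨ a = 2 := by fin_cases a <;> simp
  all_goals simp [concomitant, jet, (S.phiStar_spec _ w).2, adjointValue, phi_one]

theorem sub_mul_fourier_phi (a : Fin 3) (z w : ℂ) :
    (w - z) * S.fourier a (S.phi z 0) w = aeval z (S.charPoly a) - aeval w (S.charPoly a) := by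
  have hsign : (-1 : ℂ) ^ (a : ℕ) * (-1) ^ (a : ℕ) = 1 := by rw [← mul_pow]; simp
  have hz := (S.phi_spec z).1.lagrange_identity (S.phiStar_spec a w).1
  have hw := (S.phi_spec w).1.lagrange_identity (S.phiStar_spec a w).1
  rw [concomitant_phi_phiStar_one, concomitant_phi_phiStar_zero] at hz hw
  rw [fourier_eq_form, form_comm]
  linear_combination (-1) ^ (a : ℕ) * (hw - hz) +
    (aeval z (S.charPoly a) - aeval w (S.charPoly a)) * hsign

theorem continuous_fourier_phi (a : Fin 3) (w : ℂ) :
    Continuous fun z => S.fourier a (S.phi z 0) w := by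
  simp only [fourier_eq_sum, phi_pos]
  exact continuous_finsetSum _ fun i _ =>
    continuous_const.mul (S.jetPoly (i + 1) 0).continuous_aeval

theorem fourier_phi_self (a : Fin 3) (w : ℂ) :
    S.fourier a (S.phi w 0) w = -aeval w (derivative (S.charPoly a)) := by
  have hslope := hasDerivAt_iff_tendsto_slope.1 ((S.charPoly a).hasDerivAt_aeval w)
  have hfourier : Tendsto (fun z => -S.fourier a (S.phi z 0) w) (𝓝[≠] w)
      (𝓝 (-S.fourier a (S.phi w 0) w)) :=
    (S.continuous_fourier_phi a w).neg.continuousAt.tendsto.mono_left nhdsWithin_le_nhds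
  rw [eq_neg_iff_add_eq_zero, add_comm, ← sub_neg_eq_add, sub_eq_zero]
  refine tendsto_nhds_unique hslope (hfourier.congr' ?_)
  filter_upwards [self_mem_nhdsWithin] with z hz
  rw [slope_def_field, eq_div_iff (sub_ne_zero.2 hz), ← S.sub_mul_fourier_phi a z w]
  ring

theorem fourier_phi_eigenvalue {a : Fin 3} (x y : S.Eigenvalue a) :
    S.fourier a (S.phi x.1 0) y.1 =
      if x = y then -(((derivative (S.charPoly a)).eval x.1 : ℝ) : ℂ) else 0 := by
  split_ifs with hxy
  · rw [hxy, fourier_phi_self, aeval_complex_ofReal]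
  · have h := S.sub_mul_fourier_phi a x.1 y.1
    rw [S.mem_spectrum_iff.1 x.2, S.mem_spectrum_iff.1 y.2, sub_zero] at h
    refine (mul_eq_zero.1 h).resolve_left (sub_ne_zero.2 fun hyx => hxy ?_)
    exact Subtype.ext (Complex.ofReal_injective hyx.symm)

theorem eq_sum_fourier_mul_phi {a : Fin 3} (ha : S.Nondegenerate ∨ a = 2) (f : ℝ → ℂ)
    (i : Fin S.n) :
    f (S.pos i) = ∑ x : S.Eigenvalue a,
      S.fourier a f x.1 / -(((derivative (S.charPoly a)).eval x.1 : ℝ) : ℂ) *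
        S.phi x.1 0 (S.pos i) := by
  have hexp := eq_sum_smul_of_biorthogonal
    ((S.card_eigenvalue ha).trans (Fintype.card_fin S.n).symm)
    (φ := fun x i => S.phi x.1 0 (S.pos i))
    (ψ := fun y i => (-1) ^ (a : ℕ) * S.wt i * S.phiStar a y.1 0 (S.pos i))
    (d := fun x => -(((derivative (S.charPoly a)).eval x.1 : ℝ) : ℂ))
    (fun x => neg_ne_zero.2 (Complex.ofReal_ne_zero.2 x.eval_derivative_ne_zero))
    (fun x y => by
      rw [← fourier_phi_eigenvalue, fourier_eq_sum]
      exact Finset.sum_congr rfl fun i _ => mul_comm _ _)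
    (fun i => f (S.pos i))
  simpa only [Finset.sum_apply, Pi.smul_apply, smul_eq_mul, ← fourier_eq_sum] using congrFun hexp i

theorem add_mul_form_phi_phi (z w : ℂ) :
    (z + w) * S.form (S.phi z 0) (S.phi w 0) =
      -concomitant (jet (S.phi z) 1) (jet (S.phi w) 1) := by
  have h := (S.phi_spec z).1.lagrange_identity (S.phi_spec w).1
  have h0 : concomitant (jet (S.phi z) 0) (jet (S.phi w) 0) = 0 := by
    simp [concomitant, jet, (S.phi_spec z).2, (S.phi_spec w).2]
  linear_combination h + h0

theorem form_eq_sum_sum {ι κ : Type*} [Fintype ι] [Fintype κ] {f h : ℝ → ℂ} {r : ι → ℂ}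
    {s : κ → ℂ} {φ : ι → ℝ → ℂ} {ψ : κ → ℝ → ℂ}
    (hf : ∀ i, f (S.pos i) = ∑ x, r x * φ x (S.pos i))
    (hh : ∀ i, h (S.pos i) = ∑ y, s y * ψ y (S.pos i)) :
    S.form f h = ∑ x, ∑ y, r x * s y * S.form (φ x) (ψ y) := by
  simp only [form_eq_sum, hf, hh, Finset.sum_mul_sum]
  simp only [Finset.mul_sum]
  rw [Finset.sum_comm]
  refine Finset.sum_congr rfl fun x _ => ?_
  rw [Finset.sum_comm]
  exact Finset.sum_congr rfl fun y _ => Finset.sum_congr rfl fun i _ => by ring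

theorem form_eq_sum_fourier_mul_fourier {a b : Fin 3} (ha : S.Nondegenerate ∨ a = 2)
    (hb : S.Nondegenerate ∨ b = 2) (f h : ℝ → ℂ) :
    S.form f h = ∑ x : S.Eigenvalue a, ∑ y : S.Eigenvalue b,
      S.fourier a f x.1 / -(((derivative (S.charPoly a)).eval x.1 : ℝ) : ℂ) *
        (S.fourier b h y.1 / -(((derivative (S.charPoly b)).eval y.1 : ℝ) : ℂ)) *
        (-concomitant (jet (S.phi x.1) 1) (jet (S.phi y.1) 1) / (x.1 + y.1)) := by
  rw [S.form_eq_sum_sum (S.eq_sum_fourier_mul_phi ha f) (S.eq_sum_fourier_mul_phi hb h)]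
  refine Finset.sum_congr rfl fun x _ => Finset.sum_congr rfl fun y _ => ?_
  have hx := (S.pos_and_derivative_ne_zero (S.ofReal_mem_spectrum_iff.1 x.2)).1
  have hy := (S.pos_and_derivative_ne_zero (S.ofReal_mem_spectrum_iff.1 y.2)).1
  have hxy : (x.1 : ℂ) + y.1 ≠ 0 := by exact_mod_cast (add_pos hx hy).ne'
  rw [← add_mul_form_phi_phi, mul_div_cancel_left₀ _ hxy]

end DiscreteCubicString

namespace FactorizingPair

open DiscreteCubicString

/-- The numerator of the first Weyl function, whose denominator is the characteristic polynomial
of type `P.fst`. -/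
noncomputable def fstNum (S : DiscreteCubicString) : FactorizingPair → ℝ[X]
  | type00 => S.charPoly 1
  | type01 => S.charPoly 2
  | type12 => S.charPoly 2
  | type22 => -S.charPoly 1

/-- The numerator of the second Weyl function, whose denominator is the characteristic polynomial
of type `P.snd`. -/
noncomputable def sndNum (S : DiscreteCubicString) : FactorizingPair → ℝ[X]
  | type00 => S.charPoly 1
  | type01 => -S.charPoly 0
  | type12 => -S.charPoly 0
  | type22 => -S.charPoly 1

variable {S : DiscreteCubicString} (P : FactorizingPair)

theorem fstWeyl_eq :
    P.fstWeyl S = fun w => aeval w (P.fstNum S) / aeval w (S.charPoly P.fst) := by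
  funext w
  cases P <;> simp [fstWeyl, fstNum, fst, weylW, weylZ, phi_one, neg_div]

theorem sndWeyl_eq :
    P.sndWeyl S = fun w => aeval w (P.sndNum S) / aeval w (S.charPoly P.snd) := by
  funext w
  cases P <;> simp [sndWeyl, sndNum, snd, weylW, weylZ, phi_one, neg_div]

theorem fst_residue_pos (x : S.Eigenvalue P.fst) :
    0 < (P.fstNum S).eval x.1 / (derivative (S.charPoly P.fst)).eval x.1 := by
  have hx := S.ofReal_mem_spectrum_iff.1 x.2
  cases P
  case type22 =>
    rw [fstNum, eval_neg]
    exact (S.pos_and_div_derivative_pos_of_gt (by decide) hx).2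
  all_goals exact (S.pos_and_div_derivative_pos_of_lt (by decide) hx).2

theorem snd_residue_pos (y : S.Eigenvalue P.snd) :
    0 < (P.sndNum S).eval y.1 / (derivative (S.charPoly P.snd)).eval y.1 := by
  have hy := S.ofReal_mem_spectrum_iff.1 y.2
  cases P
  case type00 => exact (S.pos_and_div_derivative_pos_of_lt (by decide) hy).2
  all_goals
    rw [sndNum, eval_neg]
    exact (S.pos_and_div_derivative_pos_of_gt (by decide) hy).2

theorem neg_concomitant_phi_phi_eq (x : S.Eigenvalue P.fst) (y : S.Eigenvalue P.snd) :
    -concomitant (jet (S.phi x.1) 1) (jet (S.phi y.1) 1) =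
      (((P.fstNum S).eval x.1 * (P.sndNum S).eval y.1 : ℝ) : ℂ) := by
  have hx := S.ofReal_mem_spectrum_iff.1 x.2
  have hy := S.ofReal_mem_spectrum_iff.1 y.2
  cases P <;> simp_all [fst, snd, fstNum, sndNum, concomitant, jet_phi_one, aeval_complex_ofReal]

theorem form_eq_cauchyPairing (hSP : S.Nondegenerate ∨ P = type22) (f h : ℝ → ℂ) :
    S.form f h = cauchyPairing (P.alpha S) (P.beta S)
      (fun x => S.fourier P.fst f x) (fun y => S.fourier P.snd h y) := by
  have ha : S.Nondegenerate ∨ P.fst = 2 := hSP.imp_right fun h => by rw [h]; rfl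
  have hb : S.Nondegenerate ∨ P.snd = 2 := hSP.imp_right fun h => by rw [h]; rfl
  simp only [S.form_eq_sum_fourier_mul_fourier ha hb, cauchyPairing, alpha, beta, fstWeyl_eq,
    sndWeyl_eq, integral_spectralMeasure P.fst_residue_pos,
    integral_spectralMeasure P.snd_residue_pos, Finset.mul_sum, neg_concomitant_phi_phi_eq]
  refine Finset.sum_congr rfl fun x _ => Finset.sum_congr rfl fun y _ => ?_
  push_cast
  ring

end FactorizingPair

end

theorem mainTheorem1_general (S : DiscreteCubicString) (P : FactorizingPair) :
    S.PositiveSimplePoles P.fst (P.fstWeyl S) ∧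
    S.PositiveSimplePoles P.snd (P.sndWeyl S) ∧
    (S.Nondegenerate ∨ P = FactorizingPair.type22 → ∀ f h : ℝ → ℂ,
      S.form f h = cauchyPairing (P.alpha S) (P.beta S)
          (fun x => S.fourier P.fst f x) (fun y => S.fourier P.snd h y) ∧
      S.form f h = cauchyPairing (P.alpha S) (P.beta S)
          (fun x => S.fourier P.fst h x) (fun y => S.fourier P.snd f y)) := by
  refine ⟨?_, ?_, fun hSP f h => ⟨P.form_eq_cauchyPairing hSP f h, ?_⟩⟩
  · rw [P.fstWeyl_eq]
    exact DiscreteCubicString.positiveSimplePoles_of_residue_pos P.fst_residue_pos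
  · rw [P.sndWeyl_eq]
    exact DiscreteCubicString.positiveSimplePoles_of_residue_pos P.snd_residue_pos
  · rw [S.form_comm]
    exact P.form_eq_cauchyPairing hSP h f

theorem mainTheorem1 (S : DiscreteCubicString) (P : FactorizingPair)
    (hSP : S.Nondegenerate ∨ P = FactorizingPair.type22) :
    S.PositiveSimplePoles P.fst (P.fstWeyl S) ∧
    S.PositiveSimplePoles P.snd (P.sndWeyl S) ∧
    ∀ f h : Lp ℂ 2 S.mass,
      S.form f h = cauchyPairing (P.alpha S) (P.beta S)
          (fun x => S.fourier P.fst f x) (fun y => S.fourier P.snd h y) ∧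
      S.form f h = cauchyPairing (P.alpha S) (P.beta S)
          (fun x => S.fourier P.fst h x) (fun y => S.fourier P.snd f y) := by
  obtain ⟨hfst, hsnd, hform⟩ := mainTheorem1_general S P
  exact ⟨hfst, hsnd, fun f h => hform hSP f h⟩
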